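/- Let $\mathbb F\in\{\mathbb R,\mathbb C\}$ and let $d_{\ell-1},d_\ell,d_{\ell+1}\ge 2$ and $r_\ell\ge 2$ be integers. For parameters $\theta=(W_1,W_2,b_1,b_2)$ with $W_1\in\mathbb F^{d_\ell\times d_{\ell-1}}$, $W_2\in\mathbb F^{d_{\ell+1}\times d_\ell}$, $b_1\in\mathbb F^{d_\ell}$, $b_2\in\mathbb F^{d_{\ell+1}}$, the 2-layer polynomial neural network (PNN) with biases of architecture $((d_{\ell-1},d_\ell,d_{\ell+1}),(r_\ell))$ is the map $$p_\theta:\mathbb F^{d_{\ell-1}}\to\mathbb F^{d_{\ell+1}},\qquad p_\theta(x)=W_2\,\rho_{r_\ell}(W_1x+b_1)+b_2,\qquad \rho_r(z_1,\dots,z_d)=(z_1^r,\dots,z_d^r).$$ Call $\theta'$ equivalent to $\theta$ if there are a permutation matrix $P$ and an invertible diagonal matrix $D$ of size $d_\ell$ with $W_1'=PDW_1$, $b_1'=PDb_1$, $W_2'=W_2D^{-r_\ell}P^{\mathsf T}$, $b_2'=b_2$. The architecture is called identifiable over $\mathbb F$ if for all $\theta$ outside a set of Lebesgue measure zero, every $\theta'$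 with $p_{\theta'}=p_\theta$ is equivalent to $\theta$. If $$r_\ell\;\ge\;2\left\lceil\frac{2(d_\ell+1)-\min(d_\ell+1,\,d_{\ell+1})}{2\min(d_\ell+1,\,d_{\ell-1}+1)-2}\right\rceil,$$ then the 2-layer PNN with biases of architecture $((d_{\ell-1},d_\ell,d_{\ell+1}),(r_\ell))$ is identifiable, both over $\mathbb R$ and over $\mathbb C$. -/

import Mathlib

open MeasureTheory

namespace PNN

/-- The parameters `θ = ((W₁, W₂), (b₁, b₂))` of a two-layer network of widths `(d₀, d₁, d₂)`:
weights `W₁ ∈ 𝕜^{d₁ × d₀}`, `W₂ ∈ 𝕜^{d₂ × d₁}` (given by their entries) and biases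
`b₁ ∈ 𝕜^{d₁}`, `b₂ ∈ 𝕜^{d₂}`. As an iterated product of copies of `𝕜` this space carries the
product (Lebesgue) measure `volume`. -/
abbrev Params (𝕜 : Type*) (d₀ d₁ d₂ : ℕ) : Type _ :=
  ((Fin d₁ → Fin d₀ → 𝕜) × (Fin d₂ → Fin d₁ → 𝕜)) × ((Fin d₁ → 𝕜) × (Fin d₂ → 𝕜))

section

variable {𝕜 : Type*} {d₀ d₁ d₂ : ℕ}

/-- The first weight matrix. -/
def Params.W₁ (θ : Params 𝕜 d₀ d₁ d₂) : Matrix (Fin d₁) (Fin d₀) 𝕜 := Matrix.of θ.1.1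

/-- The second weight matrix. -/
def Params.W₂ (θ : Params 𝕜 d₀ d₁ d₂) : Matrix (Fin d₂) (Fin d₁) 𝕜 := Matrix.of θ.1.2

/-- The bias of the hidden layer. -/
def Params.b₁ (θ : Params 𝕜 d₀ d₁ d₂) : Fin d₁ → 𝕜 := θ.2.1

/-- The bias of the output layer. -/
def Params.b₂ (θ : Params 𝕜 d₀ d₁ d₂) : Fin d₂ → 𝕜 := θ.2.2

end

/-- The monomial activation `ρ_r (z₁, …, z_d) = (z₁ ^ r, …, z_d ^ r)`. -/
def activation {𝕜 : Type*} [Field 𝕜] {d : ℕ} (r : ℕ) (z : Fin d → 𝕜) : Fin d → 𝕜 :=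
  fun i => z i ^ r

/-- The two-layer polynomial neural network with biases
`x ↦ W₂ ρ_r (W₁ x + b₁) + b₂`, as a function `𝕜^{d₀} → 𝕜^{d₂}`. -/
def network {𝕜 : Type*} [Field 𝕜] {d₀ d₁ d₂ : ℕ} (r : ℕ) (θ : Params 𝕜 d₀ d₁ d₂) :
    (Fin d₀ → 𝕜) → (Fin d₂ → 𝕜) :=
  fun x => θ.W₂.mulVec (activation r (θ.W₁.mulVec x + θ.b₁)) + θ.b₂

/-- Equivalence of parameters: `θ'` arises from `θ` by a permutation matrix `P` and an invertible
diagonal matrix `D = diag(c)` acting on the hidden layer,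
`W₁' = P D W₁`, `b₁' = P D b₁`, `W₂' = W₂ D^{-r} Pᵀ`, `b₂' = b₂`. -/
def Equivalent {𝕜 : Type*} [Field 𝕜] {d₀ d₁ d₂ : ℕ} (r : ℕ) (θ θ' : Params 𝕜 d₀ d₁ d₂) : Prop :=
  ∃ (σ : Equiv.Perm (Fin d₁)) (c : Fin d₁ → 𝕜), (∀ i, c i ≠ 0) ∧
    θ'.W₁ = σ.permMatrix 𝕜 * Matrix.diagonal c * θ.W₁ ∧
    θ'.b₁ = (σ.permMatrix 𝕜 * Matrix.diagonal c).mulVec θ.b₁ ∧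
    θ'.W₂ = θ.W₂ * Matrix.diagonal (fun i => (c i ^ r)⁻¹) * (σ.permMatrix 𝕜).transpose ∧
    θ'.b₂ = θ.b₂

/-- The network with parameters `θ` has a unique representation: all parameters (of the same
architecture) that define the same function are equivalent to `θ`. -/
def HasUniqueRepresentation {𝕜 : Type*} [Field 𝕜] {d₀ d₁ d₂ : ℕ} (r : ℕ)
    (θ : Params 𝕜 d₀ d₁ d₂) : Prop :=
  ∀ θ' : Params 𝕜 d₀ d₁ d₂, network r θ' = network r θ → Equivalent r θ θ'

/-- The two-layer architecture `((d₀, d₁, d₂), (r))` with biases is (globally) identifiable over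
`𝕜`: the representation is unique for all parameters outside a set of Lebesgue measure zero. -/
def Identifiable (𝕜 : Type*) [Field 𝕜] [MeasureSpace 𝕜] (d₀ d₁ d₂ r : ℕ) : Prop :=
  ∀ᵐ θ : Params 𝕜 d₀ d₁ d₂ ∂volume, HasUniqueRepresentation r θ

end PNN

/-!
The output bias is the contribution of an extra hidden neuron whose linear form is the constant
`1`. After homogenizing, a network is thus a decomposition `∑ i, wᵢ φᵢ ^ r` into powers of linear
forms `φᵢ` with vector coefficients `wᵢ`, the sum running over `d₁ + 1` neurons. Polarization
turns such a decomposition into a three-way decomposition with factors `φᵢ ^ k`, `φᵢ ^ l` and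
`wᵢ`, where `k + l = r`, and Kruskal's theorem says that it is unique as soon as the Kruskal ranks
of the factors sum to at least `2 (d₁ + 1) + 2`. If any `q + 1` of the forms are linearly
independent, then so are any `k q + 1` of their `k`-th powers: a power `φᵢ ^ k` is separated from
`k q` others by a product of `k` functionals, each of which annihilates `q` of these. The bound on
`r` ensures Kruskal's condition when the `φᵢ` and the `wᵢ` have the largest possible Kruskal
ranks. The latter holds for points on the moment curve, and therefore almost everywhere, since
linear independence can fail only at finitely many points of a line through a parameter at which
it holds.
-/

namespace PNN

section Kruskal

open Finset Module

variable {F : Type*} [Field F] {ι V W : Type*} [AddCommGroup V] [Module F V] [AddCommGroup W]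
  [Module F W]

variable (F) in
/-- Every subfamily of at most `k` members is linearly independent. For families of at least `k`
vectors this says that the Kruskal rank is at least `k`. -/
def KruskalIndep (k : ℕ) (a : ι → V) : Prop :=
  ∀ s : Finset ι, #s ≤ k → LinearIndepOn F a s

theorem KruskalIndep.mono {k l : ℕ} {a : ι → V} (h : KruskalIndep F l a) (hkl : k ≤ l) :
    KruskalIndep F k a :=
  fun s hs => h s (hs.trans hkl)

theorem KruskalIndep.ne_zero {k : ℕ} {a : ι → V} (h : KruskalIndep F (k + 1) a) (i : ι) :
    a i ≠ 0 :=
  (h {i} (by simp)).ne_zero (by simp)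

theorem KruskalIndep.eq_of_mem_span {k : ℕ} {a : ι → V} (h : KruskalIndep F (k + 2) a) {i j : ι}
    (hij : a i ∈ F ∙ a j) : i = j := by
  classical
  by_contra hne
  have hli : LinearIndepOn F a (insert i {j}) := by
    simpa using h {i, j} (card_le_two.trans (by omega))
  exact hli.notMem_span_of_insert (by simpa using hne) (by simpa using hij)

theorem KruskalIndep.min_card_le_finrank_span [Fintype ι] {k : ℕ} {a : ι → V}
    (h : KruskalIndep F k a) :
    min (Fintype.card ι) k ≤ finrank F (Submodule.span F (Set.range a)) := by
  obtain ⟨s, -, hs⟩ := exists_subset_card_eq (s := (univ : Finset ι)) (min_le_left _ k)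
  calc min (Fintype.card ι) k = Fintype.card s := by rw [Fintype.card_coe, hs, card_univ]
    _ = finrank F (Submodule.span F (Set.range fun i : s => a i)) :=
        (finrank_span_eq_card (h s (by omega))).symm
    _ ≤ _ := by
        have := Module.Finite.span_of_finite F (Set.finite_range a)
        exact Submodule.finrank_mono (Submodule.span_mono (Set.range_comp_subset_range _ a))

theorem exists_dual_apply_eq_ite [DecidableEq ι] {b : ι → V} {I : Finset ι}
    (hb : LinearIndepOn F b I) :
    ∃ g : ι → Dual F V, ∀ i ∈ I, ∀ j ∈ I, g i (b j) = if i = j then 1 else 0 := by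
  obtain ⟨L, hL⟩ := LinearMap.exists_leftInverse_of_injective
    (Finsupp.linearCombination F fun i : I => b i) (LinearMap.ker_eq_bot.2 hb)
  refine ⟨fun i => if hi : i ∈ I then Finsupp.lapply ⟨i, hi⟩ ∘ₗ L else 0, fun i hi j hj => ?_⟩
  have hLb : L (b j) = Finsupp.single ⟨j, hj⟩ 1 := by
    simpa using LinearMap.congr_fun hL (Finsupp.single ⟨j, hj⟩ 1)
  simp [hi, hLb, Finsupp.single_apply, eq_comm]

theorem exists_linearIndepOn_sum_mul_dual_smul [Fintype ι] [DecidableEq ι] {b : ι → V} {c : ι → W}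
    {x : ι → F} {I J K : Finset ι} (hxI : ∀ i ∈ I, x i ≠ 0) (hx : ∀ i ∉ I ∪ J, x i = 0)
    (hKI : K ⊆ I) (hb : LinearIndepOn F b I) (hc : LinearIndepOn F c ↑(K ∪ J)) :
    ∃ g : ι → Dual F V, LinearIndepOn F (fun i => ∑ j, (x j * g i (b j)) • c j) K := by
  obtain ⟨g, hg⟩ := exists_dual_apply_eq_ite hb
  refine ⟨g, linearIndepOn_finset_iff.2 fun u hu i hi => ?_⟩
  let φ : Dual F V := ∑ i ∈ K, u i • g i
  have hφ (j) (hj : j ∈ I) : φ (b j) = if j ∈ K then u j else 0 := by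
    simp +contextual [φ, hg _ (hKI _), hj]
  have hsum : ∑ j, (x j * φ (b j)) • c j = 0 := by
    simp only [smul_sum] at hu
    rw [sum_comm] at hu
    simpa [φ, mul_sum, sum_smul, smul_smul, mul_left_comm] using hu
  have hsumKJ : ∑ j ∈ K ∪ J, (x j * φ (b j)) • c j = 0 := by
    rw [← hsum]
    refine sum_subset (subset_univ _) fun j _ hj => ?_
    by_cases hjI : j ∈ I
    · have hjK : j ∉ K := fun h => hj (mem_union_left _ h)
      rw [hφ j hjI, if_neg hjK, mul_zero, zero_smul]
    · have hjIJ : j ∉ I ∪ J := by grind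
      rw [hx j hjIJ, zero_mul, zero_smul]
  have hi0 := linearIndepOn_finset_iff.1 hc _ hsumKJ i (mem_union_left _ hi)
  simpa [hφ i (hKI hi), hi, hxI i (hKI hi)] using hi0

open scoped Classical in
/-- Sylvester's inequality bounds the rank of `∑ i, x i • b i ⊗ c i` from below by a number that is
`#{i | x i ≠ 0}` or else exceeds `#{i | x' i ≠ 0}`. -/
theorem card_support_le [Fintype ι] {b b' : ι → V} {c c' : ι → W} {β γ : ℕ}
    (hb : KruskalIndep F β b) (hc : KruskalIndep F γ c) {x x' : ι → F}
    (h : ∀ g : Dual F V, ∑ i, (x i * g (b i)) • c i = ∑ i, (x' i * g (b' i)) • c' i)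
    (hx' : #{i | x' i ≠ 0} + Fintype.card ι + 1 ≤
      min (Fintype.card ι) β + min (Fintype.card ι) γ) :
    #{i | x i ≠ 0} ≤ #{i | x' i ≠ 0} := by
  set G : Finset ι := {i | x i ≠ 0} with hG
  have hGn : #G ≤ Fintype.card ι := card_le_univ _
  obtain ⟨I, hIG, hI⟩ := exists_subset_card_eq (min_le_left #G β)
  have hGI : #(G \ I) = #G - #I := card_sdiff_of_subset hIG
  obtain ⟨K, hKI, hK⟩ := exists_subset_card_eq (s := I) (n := #I + min #G γ - #G) (by omega)
  have hKGI : #(K ∪ G \ I) ≤ γ := (card_union_le _ _).trans (by omega)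
  obtain ⟨g, hg⟩ := exists_linearIndepOn_sum_mul_dual_smul (x := x) (J := G \ I)
    (fun i hi => (mem_filter.1 (hIG hi)).2)
    (fun i hi => by rw [union_sdiff_of_subset hIG] at hi; simpa [hG] using hi) hKI (hb I (by omega))
    (hc _ hKGI)
  let s : Finset W := ({i | x' i ≠ 0} : Finset ι).image c'
  have hgs : Set.range (fun i : K => ∑ j, (x j * g i (b j)) • c j) ⊆
      (Submodule.span F (s : Set W) : Set W) := by
    rintro _ ⟨i, rfl⟩
    simp only [h]
    refine Submodule.sum_mem _ fun j _ => ?_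
    by_cases hj : x' j = 0
    · simp [hj]
    · exact Submodule.smul_mem _ _ (Submodule.subset_span (by simpa [s] using ⟨j, hj, rfl⟩))
  have hKs : #K ≤ #s := by
    have := linearIndependent_le_span' _ hg (s : Set W) hgs
    simpa using this
  have hs : #s ≤ #{i | x' i ≠ 0} := card_image_le
  omega

theorem mem_span_singleton_sup_iff {v w : V} {U : Submodule F V} (hv : v ∉ U) :
    w ∈ F ∙ v ⊔ U ↔ w ∈ U ∨ w ∉ U ∧ F ∙ w ⊔ U = F ∙ v ⊔ U := by
  refine ⟨fun hw => or_iff_not_imp_left.2 fun hwU => ⟨hwU, ?_⟩, ?_⟩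
  · have hle : F ∙ w ⊔ U ≤ F ∙ v ⊔ U :=
      sup_le ((Submodule.span_singleton_le_iff_mem _ _).2 hw) le_sup_right
    exact ((Submodule.covBy_span_singleton_sup hv).eq_or_eq le_sup_right hle).resolve_left
      fun h => hwU (h ▸ Submodule.mem_sup_left (Submodule.mem_span_singleton_self w))
  · rintro (hw | ⟨-, h⟩)
    · exact Submodule.mem_sup_right hw
    · exact h ▸ Submodule.mem_sup_left (Submodule.mem_span_singleton_self w)

open scoped Classical in
theorem card_mem_span_singleton_sup [Fintype ι] {v : V} {U : Submodule F V} (hv : v ∉ U)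
    (f : ι → V) :
    #{i | f i ∈ F ∙ v ⊔ U} =
      #{i | f i ∈ U} + #{i ∈ ({i | f i ∉ U} : Finset ι) | F ∙ f i ⊔ U = F ∙ v ⊔ U} := by
  rw [← card_union_of_disjoint]
  · congr 1
    ext i
    simp [mem_span_singleton_sup_iff hv]
  · rw [disjoint_left]
    simp +contextual

open scoped Classical in
/-- The subspaces `F ∙ a' j ⊔ U` partition the `a' j` outside `U`, so with `N ≥ 2` of them the
hypothesis sums to `(N - 1) * #{a' ∈ U} ≤ (N - 1) * #{a ∈ U}`. -/
theorem card_mem_le_of_forall_span_singleton_sup [Fintype ι] {a a' : ι → V} {U : Submodule F V}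
    (h : ∀ j, a' j ∉ U → #{i | a' i ∈ F ∙ a' j ⊔ U} ≤ #{i | a i ∈ F ∙ a' j ⊔ U})
    {j l : ι} (hj : a' j ∉ U) (hl : a' l ∉ F ∙ a' j ⊔ U) :
    #{i | a' i ∈ U} ≤ #{i | a i ∈ U} := by
  let 𝒢 := ({j | a' j ∉ U} : Finset ι).image fun j => F ∙ a' j ⊔ U
  let fiber (f : ι → V) (G : Submodule F V) : ℕ :=
    #{i ∈ ({i | f i ∉ U} : Finset ι) | F ∙ f i ⊔ U = G}
  have hle : ∀ G ∈ 𝒢, #{i | a' i ∈ U} + fiber a' G ≤ #{i | a i ∈ U} + fiber a G := by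
    simp only [𝒢, forall_mem_image, mem_filter, mem_univ, true_and, fiber]
    intro j hj
    simpa only [card_mem_span_singleton_sup hj] using h j hj
  have hsum_le := sum_le_sum hle
  simp only [sum_add_distrib, sum_const, smul_eq_mul] at hsum_le
  have hsum_fiber' : ∑ G ∈ 𝒢, fiber a' G = #{i | a' i ∉ U} := (card_eq_sum_card_image _ _).symm
  have hsum_fiber : ∑ G ∈ 𝒢, fiber a G ≤ #{i | a i ∉ U} :=
    (sum_card_fiberwise_eq_card_filter _ _ _).trans_le (card_filter_le _ _)
  have hcard (f : ι → V) : #{i | f i ∈ U} + #{i | f i ∉ U} = Fintype.card ι :=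
    (card_filter_add_card_filter_not _).trans card_univ
  have hcard_𝒢 : 1 < #𝒢 := by
    have hlU : a' l ∉ U := fun h => hl (Submodule.mem_sup_right h)
    refine one_lt_card.2 ⟨_, mem_image_of_mem _ (by simpa using hj), _,
      mem_image_of_mem _ (by simpa using hlU), fun e => hl ?_⟩
    exact e ▸ Submodule.mem_sup_left (Submodule.mem_span_singleton_self _)
  have hcard_a := hcard a
  have hcard_a' := hcard a'
  nlinarith

open scoped Classical in
theorem card_mem_le_of_le_span_singleton_sup [Fintype ι] {a a' : ι → V}
    (h : ∀ x : Dual F V,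
      #{j | x (a' j) ≠ 0} + finrank F (Submodule.span F (Set.range a')) ≤ Fintype.card ι + 1 →
        #{i | x (a i) ≠ 0} ≤ #{j | x (a' j) ≠ 0})
    {S : Set ι} {j : ι} (hj : a' j ∉ Submodule.span F (a' '' S))
    (ha : ∀ i, a i ∈ F ∙ a' j ⊔ Submodule.span F (a' '' S))
    (ha' : ∀ i, a' i ∈ F ∙ a' j ⊔ Submodule.span F (a' '' S)) :
    #{i | a' i ∈ Submodule.span F (a' '' S)} ≤ #{i | a i ∈ Submodule.span F (a' '' S)} := by
  set U := Submodule.span F (a' '' S)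
  have hj0 : a' j ≠ 0 := fun h0 => hj (h0 ▸ U.zero_mem)
  have : FiniteDimensional F U := .span_of_finite F (Set.toFinite _)
  obtain ⟨x, hxj, hxU⟩ := Submodule.exists_le_ker_of_notMem hj
  have hx_iff (u : V) (hu : u ∈ F ∙ a' j ⊔ U) : x u ≠ 0 ↔ u ∉ U := by
    refine ⟨fun hxu huU => hxu (hxU huU), fun huU hxu => hxj ?_⟩
    obtain ⟨-, hspan⟩ := ((mem_span_singleton_sup_iff hj).1 hu).resolve_left huU
    have hle : F ∙ a' j ⊔ U ≤ LinearMap.ker x :=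
      hspan ▸ sup_le ((Submodule.span_singleton_le_iff_mem _ _).2 hxu) hxU
    exact hle (Submodule.mem_sup_left (Submodule.mem_span_singleton_self _))
  have hcard (f : ι → V) : #{i | f i ∈ U} + #{i | f i ∉ U} = Fintype.card ι :=
    (card_filter_add_card_filter_not _).trans card_univ
  have hrank_U : finrank F U ≤ #{i | a' i ∈ U} := by
    have hUle : U ≤ Submodule.span F (({i | a' i ∈ U} : Finset ι).image a' : Finset V) := by
      refine Submodule.span_mono ?_
      rintro _ ⟨i, hi, rfl⟩
      simpa using ⟨i, Submodule.subset_span (Set.mem_image_of_mem a' hi), rfl⟩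
    exact (Submodule.finrank_mono hUle).trans ((finrank_span_finset_le_card _).trans card_image_le)
  have hrank : finrank F (Submodule.span F (Set.range a')) ≤ finrank F U + 1 :=
    calc finrank F (Submodule.span F (Set.range a'))
        ≤ finrank F ↥(F ∙ a' j ⊔ U) :=
          Submodule.finrank_mono (Submodule.span_le.2 (Set.range_subset_iff.2 ha'))
      _ ≤ finrank F (F ∙ a' j) + finrank F U := Submodule.finrank_add_le_finrank_add_finrank _ _
      _ = finrank F U + 1 := by rw [finrank_span_singleton hj0, add_comm]
  have hle := h x (by simp only [hx_iff _ (ha' _)]; have := hcard a'; omega)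
  simp only [hx_iff _ (ha' _), hx_iff _ (ha _)] at hle
  have hcard_a := hcard a
  have hcard_a' := hcard a'
  omega

theorem mem_span_range_of_forall_dual {a a' : ι → V}
    (h : ∀ x : Dual F V, (∀ j, x (a' j) = 0) → ∀ i, x (a i) = 0) (i : ι) :
    a i ∈ Submodule.span F (Set.range a') := by
  by_contra hi
  obtain ⟨x, hxi, hx⟩ := Submodule.exists_le_ker_of_notMem hi
  exact hxi (h x (fun j => hx (Submodule.subset_span ⟨j, rfl⟩)) i)

open scoped Classical in
theorem card_mem_span_image_le [Fintype ι] {a a' : ι → V}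
    (h : ∀ x : Dual F V,
      #{j | x (a' j) ≠ 0} + finrank F (Submodule.span F (Set.range a')) ≤ Fintype.card ι + 1 →
        #{i | x (a i) ≠ 0} ≤ #{j | x (a' j) ≠ 0})
    (S : Set ι) :
    #{j | a' j ∈ Submodule.span F (a' '' S)} ≤ #{i | a i ∈ Submodule.span F (a' '' S)} := by
  have ha (i) : a i ∈ Submodule.span F (Set.range a') := by
    refine mem_span_range_of_forall_dual (fun x hx i => ?_) i
    have hrank : finrank F (Submodule.span F (Set.range a')) ≤ Fintype.card ι :=
      finrank_range_le_card a'
    have hxi : ∀ i, x (a i) = 0 := by simpa [hx, hrank.trans (Nat.le_succ _)] using h x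
    exact hxi i
  induction S using WellFoundedGT.induction with
  | ind S ih =>
    by_cases hS : ∀ j, a' j ∈ Submodule.span F (a' '' S)
    · have hspan := Submodule.span_le.2 (Set.range_subset_iff.2 hS)
      exact card_le_card fun i _ => by simpa using hspan (ha i)
    push Not at hS
    obtain ⟨j, hj⟩ := hS
    have hspan_insert (j) :
        Submodule.span F (a' '' insert j S) = F ∙ a' j ⊔ Submodule.span F (a' '' S) := by
      rw [Set.image_insert_eq, Submodule.span_insert]
    by_cases hall : ∀ l, a' l ∈ F ∙ a' j ⊔ Submodule.span F (a' '' S)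
    · have hle := Submodule.span_le.2 (Set.range_subset_iff.2 hall)
      exact card_mem_le_of_le_span_singleton_sup h hj (fun i => hle (ha i)) hall
    push Not at hall
    obtain ⟨l, hl⟩ := hall
    refine card_mem_le_of_forall_span_singleton_sup (fun j hj => ?_) hj hl
    have hjS : j ∉ S := fun hjS => hj (Submodule.subset_span (Set.mem_image_of_mem a' hjS))
    simpa only [hspan_insert] using ih (insert j S) (Set.ssubset_insert hjS)

open scoped Classical in
/-- Kruskal's permutation lemma. The counting hypothesis passes from hyperplanes down to lines. -/
theorem KruskalIndep.exists_perm_eq_smul [Fintype ι] {a a' : ι → V} (ha : KruskalIndep F 2 a)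
    (h : ∀ x : Dual F V,
      #{j | x (a' j) ≠ 0} + finrank F (Submodule.span F (Set.range a')) ≤ Fintype.card ι + 1 →
        #{i | x (a i) ≠ 0} ≤ #{j | x (a' j) ≠ 0}) :
    ∃ τ : Equiv.Perm ι, ∀ j, ∃ t : F, t ≠ 0 ∧ a' j = t • a (τ j) := by
  have hcount (j) : #{l | a' l ∈ F ∙ a' j} ≤ #{i | a i ∈ F ∙ a' j} := by
    simpa using card_mem_span_image_le h {j}
  have hex (j) : ∃ i, a i ∈ F ∙ a' j := by
    have hpos : 0 < #{l | a' l ∈ F ∙ a' j} :=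
      card_pos.2 ⟨j, by simp [Submodule.mem_span_singleton_self]⟩
    obtain ⟨i, hi⟩ := card_pos.1 (hpos.trans_le (hcount j))
    exact ⟨i, (mem_filter.1 hi).2⟩
  choose τ hτ using hex
  have hscale (j) : ∃ t : F, t ≠ 0 ∧ a' j = t • a (τ j) := by
    obtain ⟨t, ht⟩ := Submodule.mem_span_singleton.1 (hτ j)
    have ht0 : t ≠ 0 := by
      rintro rfl
      exact ha.ne_zero (τ j) (by simpa using ht.symm)
    exact ⟨t⁻¹, inv_ne_zero ht0, by rw [← ht, inv_smul_smul₀ ht0]⟩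
  have hspan (j) : F ∙ a' j = F ∙ a (τ j) := by
    obtain ⟨t, ht0, ht⟩ := hscale j
    rw [ht, Submodule.span_singleton_smul_eq (IsUnit.mk0 t ht0)]
  have hone (j) : #{l | a' l ∈ F ∙ a' j} ≤ 1 := by
    refine (hcount j).trans (card_le_one_iff.2 fun {i l} hi hl => ?_)
    rw [hspan, mem_filter] at hi hl
    rw [ha.eq_of_mem_span hi.2, ha.eq_of_mem_span hl.2]
  have hinj : Function.Injective τ := by
    intro j l hjl
    refine card_le_one.1 (hone l) j ?_ l (by simp [Submodule.mem_span_singleton_self])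
    simp [hspan l, ← hjl, ← hspan j, Submodule.mem_span_singleton_self]
  exact ⟨.ofBijective τ hinj.bijective_of_finite, hscale⟩

theorem sum_mul_dual_eq_of_forall_apply {X : Type*} [Fintype ι] {u u' : ι → F} {f f' : ι → X → F}
    (h : ∀ x, ∑ i, u i * f i x = ∑ i, u' i * f' i x) (g : Dual F (X → F)) :
    ∑ i, u i * g (f i) = ∑ i, u' i * g (f' i) := by
  have hsum : ∑ i, u i • f i = ∑ i, u' i • f' i := by
    ext x
    simpa using h x
  simpa using congrArg g hsum

/-- Kruskal's theorem, for one of the three factors: contracting it with a functional leaves an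
identity of bilinear forms, whose ranks `card_support_le` compares. -/
theorem KruskalIndep.exists_perm_eq_smul_of_sum_mul_mul_eq [Fintype ι] {X Y Z : Type*}
    {a a' : ι → X → F} {b b' : ι → Y → F} {c c' : ι → Z → F} {α β γ : ℕ}
    (ha : KruskalIndep F α a) (hb : KruskalIndep F β b) (hc : KruskalIndep F γ c)
    (hcard : 2 * Fintype.card ι + 2 ≤
      min (Fintype.card ι) α + min (Fintype.card ι) β + min (Fintype.card ι) γ)
    (h : ∀ x y z, ∑ i, a i x * b i y * c i z = ∑ i, a' i x * b' i y * c' i z) :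
    ∃ τ : Equiv.Perm ι, ∀ j, ∃ t : F, t ≠ 0 ∧ a' j = t • a (τ j) := by
  classical
  have hdual (φ : Dual F (X → F)) (g : Dual F (Y → F)) :
      ∑ i, (φ (a i) * g (b i)) • c i = ∑ i, (φ (a' i) * g (b' i)) • c' i := by
    ext z
    have hφ (y) : ∑ i, b i y * c i z * φ (a i) = ∑ i, b' i y * c' i z * φ (a' i) :=
      sum_mul_dual_eq_of_forall_apply (fun x => by convert h x y z using 2 <;> ring) φ
    have hg : ∑ i, φ (a i) * c i z * g (b i) = ∑ i, φ (a' i) * c' i z * g (b' i) :=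
      sum_mul_dual_eq_of_forall_apply (fun y => by convert hφ y using 2 <;> ring) g
    simpa [mul_right_comm] using hg
  have hsupp (φ : Dual F (X → F)) := card_support_le hb hc (hdual φ)
  have hspan : Submodule.span F (Set.range a) ≤ Submodule.span F (Set.range a') := by
    refine Submodule.span_le.2 (Set.range_subset_iff.2 (mem_span_range_of_forall_dual ?_))
    intro φ hφ i
    have hcard0 := hsupp φ
    simp only [hφ, ne_eq, not_true, filter_false, card_empty, Nat.le_zero, card_eq_zero,
      filter_eq_empty_iff, not_not] at hcard0
    exact hcard0 (by omega) (mem_univ i)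
  have hrank : min (Fintype.card ι) α ≤ finrank F (Submodule.span F (Set.range a')) := by
    have := Module.Finite.span_of_finite F (Set.finite_range a')
    exact ha.min_card_le_finrank_span.trans (Submodule.finrank_mono hspan)
  exact (ha.mono (by omega)).exists_perm_eq_smul fun φ hφ => hsupp φ (by omega)

end Kruskal

section Powers

open Finset Module Polynomial

variable {F : Type*} [Field F] {ι E : Type*} [AddCommGroup E] [Module F E]

theorem sum_mul_pow_mul_pow_eq_zero [CharZero F] {s : Finset ι} {u : ι → F} {φ : ι → Dual F E}
    {k l : ℕ} (h : ∀ z, ∑ i ∈ s, u i * φ i z ^ (k + l) = 0) (x y : E) :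
    ∑ i ∈ s, u i * (φ i x ^ k * φ i y ^ l) = 0 := by
  let P : F[X] := ∑ i ∈ s, C (u i) * ((X + C (φ i x)) ^ (k + l)).comp (C (φ i y) * X)
  have hP : P = 0 := Polynomial.funext fun t => by
    simpa [P, eval_finsetSum, add_comm, mul_comm t] using h (x + t • y)
  have hcoeff : P.coeff l = (∑ i ∈ s, u i * (φ i x ^ k * φ i y ^ l)) * (k + l).choose l := by
    simp only [P, finsetSum_coeff, coeff_C_mul, comp_C_mul_X_coeff, coeff_X_add_C_pow,
      Nat.add_sub_cancel, sum_mul]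
    exact sum_congr rfl fun i _ => by ring
  have hchoose : ((k + l).choose l : F) ≠ 0 := by
    exact_mod_cast (Nat.choose_pos (Nat.le_add_left l k)).ne'
  simpa [hP, hchoose] using hcoeff

theorem sum_mul_pow_mul_pow_eq [CharZero F] [Fintype ι] {u u' : ι → F} {φ φ' : ι → Dual F E}
    {k l : ℕ} (h : ∀ z, ∑ i, u i * φ i z ^ (k + l) = ∑ i, u' i * φ' i z ^ (k + l)) (x y : E) :
    ∑ i, u i * (φ i x ^ k * φ i y ^ l) = ∑ i, u' i * (φ' i x ^ k * φ' i y ^ l) := by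
  have hzero := sum_mul_pow_mul_pow_eq_zero (s := univ) (u := Sum.elim u (-u'))
    (φ := Sum.elim φ φ') (k := k) (l := l) (fun z => by simp [h z]) x y
  simpa [← sub_eq_add_neg, sub_eq_zero] using hzero

theorem exists_forall_apply_eq_zero_of_notMem {q : ℕ} {φ : ι → Dual F E}
    (hφ : KruskalIndep F (q + 1) φ) {s : Finset ι} (hs : #s ≤ q) {i : ι} (hi : i ∉ s) :
    ∃ x, (∀ j ∈ s, φ j x = 0) ∧ φ i x ≠ 0 := by
  classical
  have hli : LinearIndepOn F φ (insert i (s : Set ι)) := by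
    simpa using hφ (insert i s) ((card_insert_le _ _).trans (by omega))
  by_contra! hker
  refine hli.notMem_span_of_insert (by simpa using hi) ?_
  rw [Set.image_eq_range]
  exact mem_span_of_iInf_ker_le_ker fun x hx => hker x (by simpa using hx)

theorem KruskalIndep.pow [CharZero F] {q : ℕ} {φ : ι → Dual F E} (hφ : KruskalIndep F (q + 1) φ)
    (k : ℕ) : KruskalIndep F (k * q + 1) fun i z => φ i z ^ k := by
  classical
  induction k with
  | zero =>
    intro s hs
    refine linearIndepOn_finset_iff.2 fun u hu i hi => ?_
    have hsi : s = {i} :=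
      eq_singleton_iff_unique_mem.2 ⟨hi, fun j hj => card_le_one.1 (by omega) j hj i hi⟩
    simpa [hsi] using congrFun hu 0
  | succ k ih =>
    intro s hs
    refine linearIndepOn_finset_iff.2 fun u hu i hi => ?_
    obtain ⟨t, hts, ht⟩ := exists_subset_card_eq (s := s.erase i) (min_le_left _ q)
    have hit : i ∉ t := fun h => notMem_erase i s (hts h)
    obtain ⟨y, hyt, hyi⟩ := exists_forall_apply_eq_zero_of_notMem hφ (s := t) (by omega) hit
    have hpolar (x) : ∑ j ∈ s, u j * (φ j x ^ k * φ j y ^ 1) = 0 :=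
      sum_mul_pow_mul_pow_eq_zero (fun z => by simpa using congrFun hu z) x y
    have hsum : ∑ j ∈ s \ t, (u j * φ j y) • (fun x => φ j x ^ k) = 0 := by
      ext x
      have hst : ∑ j ∈ s \ t, u j * (φ j x ^ k * φ j y ^ 1) = 0 := by
        rw [← hpolar x]
        exact sum_subset sdiff_subset fun j hj hjt => by simp [hyt j (by simp_all)]
      simpa [mul_assoc, mul_comm (φ _ y)] using hst
    have hcard : #(s \ t) ≤ k * q + 1 := by
      rw [card_sdiff_of_subset (hts.trans (erase_subset i s)), ht, card_erase_of_mem hi]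
      rw [add_mul, one_mul] at hs
      omega
    have hui := linearIndepOn_finset_iff.1 (ih _ hcard) _ hsum i (mem_sdiff.2 ⟨hi, hit⟩)
    exact (mul_eq_zero.1 hui).resolve_right hyi

theorem exists_eq_smul_of_pow_eq_smul_pow {k : ℕ} (hk : 0 < k) {φ ψ : Dual F E} {t : F}
    (ht : t ≠ 0) (hψ : ψ ≠ 0) (h : (fun z => φ z ^ k) = t • fun z => ψ z ^ k) :
    ∃ u : F, u ≠ 0 ∧ φ = u • ψ := by
  have hφψ (z) : φ z = 0 ↔ ψ z = 0 := by
    have hz : φ z ^ k = t * ψ z ^ k := congrFun h z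
    rw [← pow_eq_zero_iff hk.ne', hz, mul_eq_zero, or_iff_right ht, pow_eq_zero_iff hk.ne']
  have hmem : φ ∈ F ∙ ψ := by
    rw [← Set.range_const (ι := Unit) (c := ψ)]
    exact mem_span_of_iInf_ker_le_ker fun z hz => (hφψ z).2 (by simpa using hz)
  obtain ⟨u, rfl⟩ := Submodule.mem_span_singleton.1 hmem
  refine ⟨u, ?_, rfl⟩
  rintro rfl
  exact hψ (LinearMap.ext fun z => (hφψ z).1 (by simp))

theorem KruskalIndep.exists_perm_eq_smul_of_sum_mul_pow_eq [CharZero F] [Fintype ι] {Z : Type*}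
    {φ φ' : ι → Dual F E} {w w' : ι → Z → F} {q m k l : ℕ} (hk : 0 < k)
    (hφ : KruskalIndep F (q + 1) φ) (hw : KruskalIndep F m w)
    (hcard : 2 * Fintype.card ι + 2 ≤ min (Fintype.card ι) (k * q + 1) +
      min (Fintype.card ι) (l * q + 1) + min (Fintype.card ι) m)
    (h : ∀ z s, ∑ i, w i s * φ i z ^ (k + l) = ∑ i, w' i s * φ' i z ^ (k + l)) :
    ∃ (τ : Equiv.Perm ι) (u : ι → F), ∀ j, u j ≠ 0 ∧ φ' j = u j • φ (τ j) ∧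
      w (τ j) = u j ^ (k + l) • w' j := by
  obtain ⟨τ, hτ⟩ := (hφ.pow k).exists_perm_eq_smul_of_sum_mul_mul_eq
    (a' := fun i z => φ' i z ^ k) (b' := fun i z => φ' i z ^ l) (hφ.pow l) hw hcard
    (fun x y s => by
      simpa only [mul_comm] using sum_mul_pow_mul_pow_eq (fun z => h z s) x y)
  have hsmul (j) : ∃ u : F, u ≠ 0 ∧ φ' j = u • φ (τ j) := by
    obtain ⟨t, ht, hj⟩ := hτ j
    exact exists_eq_smul_of_pow_eq_smul_pow hk ht (hφ.ne_zero _) hj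
  choose u hu hφ' using hsmul
  refine ⟨τ, u, fun j => ⟨hu j, hφ' j, ?_⟩⟩
  have hindep : LinearIndepOn F (fun i z => φ i z ^ (k + l)) (univ : Finset ι) :=
    hφ.pow (k + l) _ (by rw [card_univ, add_mul]; omega)
  ext s
  have hsum : ∑ i, (w i s - u (τ.symm i) ^ (k + l) * w' (τ.symm i) s) •
      (fun z => φ i z ^ (k + l)) = 0 := by
    ext z
    simp only [Finset.sum_apply, Pi.smul_apply, Pi.zero_apply, smul_eq_mul, sub_mul,
      sum_sub_distrib, h, sub_eq_zero]
    rw [← Equiv.sum_comp τ fun i => u (τ.symm i) ^ (k + l) * w' (τ.symm i) s * φ i z ^ (k + l)]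
    refine sum_congr rfl fun j _ => ?_
    rw [hφ' j, Equiv.symm_apply_apply, LinearMap.smul_apply, smul_eq_mul, mul_pow]
    ring
  simpa [sub_eq_zero] using linearIndepOn_finset_iff.1 hindep _ hsum (τ j) (mem_univ _)

theorem sum_mul_pow_eq_of_forall_one [Infinite F] [Fintype ι] {n : ℕ} {u u' : ι → F}
    {φ φ' : ι → Dual F (F × E)}
    (h : ∀ x, ∑ i, u i * φ i (1, x) ^ n = ∑ i, u' i * φ' i (1, x) ^ n) (z : F × E) :
    ∑ i, u i * φ i z ^ n = ∑ i, u' i * φ' i z ^ n := by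
  let P (v : ι → F) (ψ : ι → Dual F (F × E)) : F[X] :=
    ∑ i, C (v i) * (C (ψ i (0, z.2)) + C (ψ i (1, 0)) * X) ^ n
  have hline (ψ : Dual F (F × E)) (t : F) : ψ (t, z.2) = ψ (0, z.2) + ψ (1, 0) * t := by
    rw [mul_comm, ← smul_eq_mul, ← map_smul, ← map_add]
    simp
  have hP (v ψ t) : (P v ψ).eval t = ∑ i, v i * ψ i (t, z.2) ^ n := by
    simp [P, eval_finsetSum, hline _ t]
  have hscale (v : ι → F) (ψ : ι → Dual F (F × E)) {t : F} (ht : t ≠ 0) :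
      ∑ i, v i * ψ i (t, z.2) ^ n = t ^ n * ∑ i, v i * ψ i (1, t⁻¹ • z.2) ^ n := by
    have hz : (t, z.2) = t • ((1 : F), t⁻¹ • z.2) := by simp [ht]
    simp only [hz, map_smul, smul_eq_mul, mul_pow, mul_sum, mul_left_comm]
  have hPP : P u φ = P u' φ' := by
    refine eq_of_infinite_eval_eq _ _ ((Set.finite_singleton (0 : F)).infinite_compl.mono ?_)
    intro t ht
    simp only [Set.mem_ofPred_eq, hP, hscale _ _ ht, h]
  simpa [hP] using congrArg (eval z.1) hPP

end Powers

section Network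

open Module

variable {𝕜 : Type*} [Field 𝕜] {d₀ d₁ d₂ : ℕ}

/-- The linear forms `(t, x) ↦ t b₁ᵢ + (W₁ x)ᵢ` of the hidden neurons, homogenized by the extra
variable `t`, together with the form `(t, x) ↦ t`, indexed by `none`, of an extra neuron that
carries the output bias. -/
def innerForm (θ : Params 𝕜 d₀ d₁ d₂) : Option (Fin d₁) → Dual 𝕜 (𝕜 × (Fin d₀ → 𝕜))
  | none => LinearMap.fst 𝕜 𝕜 (Fin d₀ → 𝕜)
  | some i => (θ.b₁ i • LinearMap.id).coprod (LinearMap.proj i ∘ₗ θ.W₁.mulVecLin)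

/-- The outgoing weights of the hidden neurons, i.e. the columns of `W₂`, together with the output
bias `b₂`, indexed by `none`, as the outgoing weights of the extra neuron of `innerForm`. -/
def outerCol (θ : Params 𝕜 d₀ d₁ d₂) : Option (Fin d₁) → Fin d₂ → 𝕜
  | none => θ.b₂
  | some i => θ.W₂.col i

theorem network_apply (r : ℕ) (θ : Params 𝕜 d₀ d₁ d₂) (x : Fin d₀ → 𝕜) (s : Fin d₂) :
    network r θ x s = ∑ i, outerCol θ i s * innerForm θ i (1, x) ^ r := by
  simp [Fintype.sum_option, network, outerCol, innerForm, Matrix.mulVec_eq_sum, activation,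
    add_comm, mul_comm]

theorem equivalent_of_forall_eq_mul {r : ℕ} {θ θ' : Params 𝕜 d₀ d₁ d₂} (σ : Equiv.Perm (Fin d₁))
    {c : Fin d₁ → 𝕜} (hc : ∀ i, c i ≠ 0) (hW₁ : ∀ i p, θ'.W₁ i p = c i * θ.W₁ (σ i) p)
    (hb₁ : ∀ i, θ'.b₁ i = c i * θ.b₁ (σ i)) (hW₂ : ∀ s i, θ.W₂ s (σ i) = c i ^ r * θ'.W₂ s i)
    (hb₂ : θ'.b₂ = θ.b₂) : Equivalent r θ θ' := by
  refine ⟨σ, fun i => c (σ.symm i), fun i => hc _, ?_, ?_, ?_, hb₂⟩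
  · ext i p
    rw [Matrix.mul_assoc, Equiv.Perm.permMatrix, PEquiv.toMatrix_toPEquiv_mul]
    simp [hW₁]
  · ext i
    simp [← Matrix.mulVec_mulVec, Matrix.permMatrix_mulVec, Matrix.mulVec_diagonal, hb₁]
  · ext s i
    have hσ : σ⁻¹.symm i = σ i := rfl
    simp [Matrix.transpose_permMatrix, Equiv.Perm.permMatrix, PEquiv.mul_toMatrix_toPEquiv,
      hσ, hW₂, mul_right_comm, hc]

theorem equivalent_of_innerForm_eq_smul {r : ℕ} {θ θ' : Params 𝕜 d₀ d₁ d₂}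
    {τ : Equiv.Perm (Option (Fin d₁))} {u : Option (Fin d₁) → 𝕜} (hτ : τ none = none)
    (hu : ∀ j, u j ≠ 0) (hφ : ∀ j, innerForm θ' j = u j • innerForm θ (τ j))
    (hw : ∀ j, outerCol θ (τ j) = u j ^ r • outerCol θ' j) : Equivalent r θ θ' := by
  have hτ_some (i) : τ (some i) = some (τ.removeNone i) := by
    refine (Equiv.removeNone_some τ (Option.ne_none_iff_exists'.1 fun h => ?_)).symm
    simpa using τ.injective (h.trans hτ.symm)
  have hu_none : u none = 1 := by
    simpa [innerForm, hτ] using (LinearMap.congr_fun (hφ none) (1, 0)).symm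
  have hφ_some (i z) : innerForm θ' (some i) z =
      u (some i) * innerForm θ (some (τ.removeNone i)) z := by
    rw [hφ, hτ_some, LinearMap.smul_apply, smul_eq_mul]
  refine equivalent_of_forall_eq_mul (Equiv.removeNone τ) (fun i => hu (some i)) (fun i p => ?_)
    (fun i => ?_) (fun s i => ?_) ?_
  · simpa [innerForm] using hφ_some i (0, Pi.single p 1)
  · simpa [innerForm] using hφ_some i (1, 0)
  · simpa [outerCol, hτ_some] using congrFun (hw (some i)) s
  · simpa [outerCol, hτ, hu_none] using (hw none).symm

theorem hasUniqueRepresentation_of_kruskalIndep [CharZero 𝕜] {q m k l : ℕ} (hk : 0 < k)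
    {θ : Params 𝕜 d₀ d₁ d₂} (hφ : KruskalIndep 𝕜 (q + 1) (innerForm θ))
    (hw : KruskalIndep 𝕜 m (outerCol θ))
    (hcard : 2 * (d₁ + 1) + 2 ≤
      min (d₁ + 1) (k * q + 1) + min (d₁ + 1) (l * q + 1) + min (d₁ + 1) m) :
    HasUniqueRepresentation (k + l) θ := by
  intro θ' hθ'
  have hsum (s) (x) : ∑ i, outerCol θ i s * innerForm θ i (1, x) ^ (k + l) =
      ∑ i, outerCol θ' i s * innerForm θ' i (1, x) ^ (k + l) := by
    rw [← network_apply, ← network_apply, hθ']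
  obtain ⟨τ, u, hτu⟩ := hφ.exists_perm_eq_smul_of_sum_mul_pow_eq hk hw (by simpa using hcard)
    fun z s => sum_mul_pow_eq_of_forall_one (hsum s) z
  obtain ⟨p, rfl⟩ : ∃ p, q = p + 1 := by
    refine Nat.exists_eq_add_one_of_ne_zero ?_
    rintro rfl
    simp only [mul_zero] at hcard
    omega
  have hτ : τ none = none := by
    obtain ⟨-, hnone, -⟩ := hτu none
    exact (hφ.eq_of_mem_span (Submodule.mem_span_singleton.2 ⟨u none, hnone.symm⟩)).symm
  exact equivalent_of_innerForm_eq_smul hτ (fun j => (hτu j).1) (fun j => (hτu j).2.1)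
    fun j => (hτu j).2.2

end Network

section Genericity

open Set Finset Module Filter

theorem finite_setOf_not_linearIndependent_add_smul {F ι V : Type*} [Field F] [Finite ι]
    [AddCommGroup V] [Module F V] {a : ι → V} (ha : LinearIndependent F a) (b : ι → V) :
    {t : F | ¬ LinearIndependent F (a + t • b)}.Finite := by
  have := Fintype.ofFinite ι
  obtain ⟨g, hg⟩ := (Fintype.linearCombination F a).exists_leftInverse_of_injective
    (LinearMap.ker_eq_bot.2 ha.fintypeLinearCombination_injective)
  let B : End F (ι → F) := g ∘ₗ Fintype.linearCombination F b
  have hB (t : F) (x : ι → F) :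
      g (Fintype.linearCombination F (a + t • b) x) = x + t • B x := by
    have hga : g (Fintype.linearCombination F a x) = x := LinearMap.congr_fun hg x
    have hab : Fintype.linearCombination F (a + t • b) x =
        Fintype.linearCombination F a x + t • Fintype.linearCombination F b x := by
      simp [Fintype.linearCombination_apply, sum_add_distrib, smul_sum, smul_comm t]
    rw [hab, map_add, hga, map_smul, LinearMap.comp_apply]
  refine (B.finite_hasEigenvalue.preimage (f := fun t => -t⁻¹)
    (neg_injective.comp inv_injective).injOn).subset fun t ht => ?_
  rw [mem_ofPred_eq, linearIndependent_iff_injective_fintypeLinearCombination,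
    ← LinearMap.ker_eq_bot, LinearMap.ker_eq_bot'] at ht
  push Not at ht
  obtain ⟨x, hx, hx0⟩ := ht
  have hxB : x + t • B x = 0 := by rw [← hB, hx, map_zero]
  have ht0 : t ≠ 0 := by
    rintro rfl
    exact hx0 (by simpa using hxB)
  refine End.hasEigenvalue_of_hasEigenvector (x := x) ⟨End.mem_eigenspace_iff.2 ?_, hx0⟩
  rw [neg_smul, ← smul_neg, ← eq_neg_of_add_eq_zero_right hxB, inv_smul_smul₀ ht0]

variable {𝕜 E : Type*} [NontriviallyNormedField 𝕜] [ProperSpace 𝕜] [NormedAddCommGroup E]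
  [NormedSpace 𝕜 E] [FiniteDimensional 𝕜 E] [MeasurableSpace E] [BorelSpace E]

theorem ae_mem_of_forall_ae_add_smul_mem [MeasurableSpace 𝕜] [BorelSpace 𝕜] (ν : Measure 𝕜)
    [ν.IsAddHaarMeasure] (μ : Measure E) [μ.IsAddHaarMeasure] {s : Set E} (hs : MeasurableSet s)
    (x : E) (h : ∀ v, ∀ᵐ t ∂ν, x + t • v ∈ s) : ∀ᵐ y ∂μ, y ∈ s := by
  have := FiniteDimensional.proper 𝕜 E
  have hmeas : MeasurableSet {p : E × 𝕜 | x + p.2 • p.1 ∈ s} :=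
    measurableSet_preimage (by fun_prop) hs
  have hswap : ∀ᵐ t ∂ν, ∀ᵐ v ∂μ, x + t • v ∈ s :=
    (Measure.ae_ae_comm hmeas).1 (Eventually.of_forall h)
  obtain ⟨t, hst, ht⟩ := (hswap.and (compl_mem_ae_iff.2 (measure_singleton 0))).exists
  have hscale : ∀ᵐ v ∂μ, x + v ∈ s :=
    (ae_comp_linearMap_mem_iff (LinearEquiv.smulOfNeZero 𝕜 E t ht).toLinearMap μ μ
      (LinearEquiv.surjective _) (measurableSet_preimage (measurable_const_add x) hs)).1 hst
  exact (eventually_add_left_iff μ x).1 hscale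

theorem ae_linearIndependent (μ : Measure E) [μ.IsAddHaarMeasure] {ι V : Type*} [Finite ι]
    [AddCommGroup V] [Module 𝕜 V] (Y : E →ᵃ[𝕜] (ι → V)) {x : E}
    (hx : LinearIndependent 𝕜 (Y x)) : ∀ᵐ y ∂μ, LinearIndependent 𝕜 (Y y) := by
  have := Fintype.ofFinite ι
  obtain ⟨g, hg⟩ := (Fintype.linearCombination 𝕜 (Y x)).exists_leftInverse_of_injective
    (LinearMap.ker_eq_bot.2 hx.fintypeLinearCombination_injective)
  let Z : E →ᵃ[𝕜] (ι → ι → 𝕜) := (g.compLeft ι).toAffineMap.comp Y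
  have hZx : LinearIndependent 𝕜 (Z x) := by
    classical
    have hZx : Z x = fun i => Pi.single i 1 := by
      ext1 i
      simpa [Z] using LinearMap.congr_fun hg (Pi.single i 1)
    rw [hZx]
    exact Pi.linearIndependent_single_one ι 𝕜
  have hopen : IsOpen {y | LinearIndependent 𝕜 (Z y)} :=
    isOpen_setOfPred_linearIndependent.preimage Z.continuous_of_finiteDimensional
  borelize 𝕜
  have hline (v : E) :
      ∀ᵐ t ∂(Measure.addHaar : Measure 𝕜), LinearIndependent 𝕜 (Z (x + t • v)) := by
    have hfin := finite_setOf_not_linearIndependent_add_smul hZx (Z.linear v)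
    filter_upwards [compl_mem_ae_iff.2 (hfin.measure_zero Measure.addHaar)] with t ht
    have hZ : Z (x + t • v) = Z x + t • Z.linear v := by
      rw [add_comm x, ← vadd_eq_add, Z.map_vadd, map_smul, vadd_eq_add, add_comm]
    rw [hZ]
    simpa using ht
  filter_upwards [ae_mem_of_forall_ae_add_smul_mem _ μ hopen.measurableSet x hline] with y hy
  exact LinearIndependent.of_comp g hy

theorem ae_kruskalIndep (μ : Measure E) [μ.IsAddHaarMeasure] {ι V : Type*} [Finite ι]
    [AddCommGroup V] [Module 𝕜 V] (Y : E →ᵃ[𝕜] (ι → V)) {k : ℕ} {x : E}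
    (hx : KruskalIndep 𝕜 k (Y x)) : ∀ᵐ y ∂μ, KruskalIndep 𝕜 k (Y y) := by
  refine ae_all_iff.2 fun s => ?_
  by_cases hs : #s ≤ k
  · filter_upwards [ae_linearIndependent μ ((LinearMap.funLeft 𝕜 V
      (Subtype.val : s → ι)).toAffineMap.comp Y) (hx s hs)] with y hy _ using hy
  · exact Eventually.of_forall fun _ h => absurd h hs

end Genericity

section GenericNetwork

open Module

variable {𝕜 : Type*} {d₀ d₁ d₂ : ℕ}

theorem kruskalIndep_pow [Field 𝕜] {ι : Type*} {x : ι → 𝕜} (hx : Function.Injective x) (n : ℕ) :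
    KruskalIndep 𝕜 n fun i (p : Fin n) => x i ^ (p : ℕ) := by
  intro s hs
  have hli : LinearIndependent 𝕜 (Matrix.vandermonde fun i => x (s.equivFin.symm i)).row :=
    Matrix.linearIndependent_rows_of_det_ne_zero (Matrix.det_vandermonde_ne_zero_iff.2
      (hx.comp (Subtype.val_injective.comp s.equivFin.symm.injective)))
  rw [LinearIndepOn, ← linearIndependent_equiv s.equivFin.symm]
  exact LinearIndependent.of_comp (LinearMap.funLeft 𝕜 𝕜 (Fin.castLE hs)) hli

/-- Pairwise distinct elements of a field of characteristic zero, indexed by the hidden neurons and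
the extra neuron `none` of `innerForm`. The value `0` at `none` makes the point of the moment curve
with this parameter agree with the fixed form of the extra neuron. -/
def node (𝕜 : Type*) [Field 𝕜] : Option (Fin d₁) → 𝕜
  | none => 0
  | some i => (i : ℕ) + 1

theorem node_injective (𝕜 : Type*) [Field 𝕜] [CharZero 𝕜] :
    Function.Injective (node 𝕜 : Option (Fin d₁) → 𝕜) := by
  rintro (_ | i) (_ | j) h
  · rfl
  · exact absurd h.symm (Nat.cast_add_one_ne_zero _)
  · exact absurd h (Nat.cast_add_one_ne_zero _)
  · simp only [node, add_left_inj, Nat.cast_inj] at h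
    rw [Fin.ext h]

variable (𝕜 d₀ d₁ d₂) in
/-- Parameters for which both `innerForm` and `outerCol` lie on a moment curve, hence have the
largest possible Kruskal ranks. -/
def vandermondeParams [Field 𝕜] : Params 𝕜 d₀ d₁ d₂ :=
  ((fun i p => node 𝕜 (some i) ^ ((p : ℕ) + 1), fun s i => node 𝕜 (some i) ^ (s : ℕ)),
    (1, fun s => node 𝕜 (none : Option (Fin d₁)) ^ (s : ℕ)))

theorem kruskalIndep_innerForm_vandermondeParams [Field 𝕜] [CharZero 𝕜] :
    KruskalIndep 𝕜 (d₀ + 1) (innerForm (vandermondeParams 𝕜 d₀ d₁ d₂)) := by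
  let e : Fin (d₀ + 1) → 𝕜 × (Fin d₀ → 𝕜) := Fin.cons (1, 0) fun p => (0, Pi.single p 1)
  let coeff : Dual 𝕜 (𝕜 × (Fin d₀ → 𝕜)) →ₗ[𝕜] Fin (d₀ + 1) → 𝕜 :=
    LinearMap.pi fun p => LinearMap.applyₗ (e p)
  have hcoeff (i) : coeff (innerForm (vandermondeParams 𝕜 d₀ d₁ d₂) i) =
      fun p : Fin (d₀ + 1) => node 𝕜 i ^ (p : ℕ) := by
    ext p
    cases i <;> cases p using Fin.cases <;>
      simp [coeff, e, innerForm, vandermondeParams, node, Params.W₁, Params.b₁]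
  intro s hs
  refine LinearIndependent.of_comp coeff ?_
  simpa only [Function.comp_def, hcoeff] using
    (kruskalIndep_pow (node_injective 𝕜) (d₀ + 1) s hs).linearIndependent

theorem kruskalIndep_outerCol_vandermondeParams [Field 𝕜] [CharZero 𝕜] :
    KruskalIndep 𝕜 d₂ (outerCol (vandermondeParams 𝕜 d₀ d₁ d₂)) := by
  have hcol : outerCol (vandermondeParams 𝕜 d₀ d₁ d₂) =
      fun i (p : Fin d₂) => node 𝕜 i ^ (p : ℕ) := by
    ext (_ | i) p <;> rfl
  exact hcol ▸ kruskalIndep_pow (node_injective 𝕜) d₂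

theorem exists_affineMap_eq_innerForm [Field 𝕜] :
    ∃ Y : Params 𝕜 d₀ d₁ d₂ →ᵃ[𝕜] (Option (Fin d₁) → Dual 𝕜 (𝕜 × (Fin d₀ → 𝕜))),
      ⇑Y = innerForm := by
  let L : Params 𝕜 d₀ d₁ d₂ →ₗ[𝕜] Option (Fin d₁) → Dual 𝕜 (𝕜 × (Fin d₀ → 𝕜)) :=
    { toFun := fun θ => innerForm θ - innerForm (0 : Params 𝕜 d₀ d₁ d₂)
      map_add' := fun θ η => by
        ext (_ | i) p <;> simp [innerForm, Params.W₁, Params.b₁]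
      map_smul' := fun c θ => by
        ext (_ | i) p <;> simp [innerForm, Params.W₁, Params.b₁] }
  exact ⟨AffineMap.mk' innerForm L 0 fun θ => by simp [L], rfl⟩

theorem exists_affineMap_eq_outerCol [Field 𝕜] :
    ∃ Y : Params 𝕜 d₀ d₁ d₂ →ᵃ[𝕜] (Option (Fin d₁) → Fin d₂ → 𝕜), ⇑Y = outerCol := by
  let L : Params 𝕜 d₀ d₁ d₂ →ₗ[𝕜] Option (Fin d₁) → Fin d₂ → 𝕜 :=
    { toFun := outerCol
      map_add' := fun θ η => by ext (_ | i) s <;> rfl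
      map_smul' := fun c θ => by ext (_ | i) s <;> rfl }
  exact ⟨L.toAffineMap, rfl⟩

variable [NontriviallyNormedField 𝕜] [ProperSpace 𝕜] [MeasureSpace 𝕜] [BorelSpace 𝕜]

variable [(volume : Measure 𝕜).IsAddHaarMeasure]

instance instIsAddHaarMeasureVolumeParams :
    (volume : Measure (Params 𝕜 d₀ d₁ d₂)).IsAddHaarMeasure := by
  have hpi (m n) : (volume : Measure (Fin m → Fin n → 𝕜)).IsAddHaarMeasure :=
    Measure.pi.isAddHaarMeasure _
  have hW : (volume : Measure ((Fin d₁ → Fin d₀ → 𝕜) × (Fin d₂ → Fin d₁ → 𝕜))).IsAddHaarMeasure :=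
    Measure.prod.instIsAddHaarMeasure _ _
  have hb : (volume : Measure ((Fin d₁ → 𝕜) × (Fin d₂ → 𝕜))).IsAddHaarMeasure :=
    Measure.prod.instIsAddHaarMeasure _ _
  have hW_add : MeasurableAdd ((Fin d₁ → Fin d₀ → 𝕜) × (Fin d₂ → Fin d₁ → 𝕜)) :=
    ContinuousAdd.measurableAdd
  have hb_add : MeasurableAdd ((Fin d₁ → 𝕜) × (Fin d₂ → 𝕜)) := ContinuousAdd.measurableAdd
  have h𝕜 : SigmaCompactSpace 𝕜 := inferInstance
  exact Measure.prod.instIsAddHaarMeasure _ _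

variable [CharZero 𝕜]

theorem ae_kruskalIndep_innerForm :
    ∀ᵐ θ : Params 𝕜 d₀ d₁ d₂, KruskalIndep 𝕜 (d₀ + 1) (innerForm θ) := by
  obtain ⟨Y, hY⟩ := exists_affineMap_eq_innerForm (𝕜 := 𝕜) (d₀ := d₀) (d₁ := d₁) (d₂ := d₂)
  exact hY ▸ ae_kruskalIndep volume Y (hY ▸ kruskalIndep_innerForm_vandermondeParams)

theorem ae_kruskalIndep_outerCol :
    ∀ᵐ θ : Params 𝕜 d₀ d₁ d₂, KruskalIndep 𝕜 d₂ (outerCol θ) := by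
  obtain ⟨Y, hY⟩ := exists_affineMap_eq_outerCol (𝕜 := 𝕜) (d₀ := d₀) (d₁ := d₁) (d₂ := d₂)
  exact hY ▸ ae_kruskalIndep volume Y (hY ▸ kruskalIndep_outerCol_vandermondeParams)

end GenericNetwork

theorem two_mul_add_two_le_of_ceil_le {d₀ d₁ d₂ r : ℕ} (h₀ : 0 < d₀) (h₁ : 0 < d₁)
    (h₂ : 2 ≤ d₂)
    (hdeg : 2 * ⌈(2 * ((d₁ : ℚ) + 1) - min ((d₁ : ℚ) + 1) (d₂ : ℚ)) /
      (2 * min ((d₁ : ℚ) + 1) ((d₀ : ℚ) + 1) - 2)⌉ ≤ (r : ℤ)) :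
    2 * (d₁ + 1) + 2 ≤ min (d₁ + 1) (r / 2 * d₀ + 1) + min (d₁ + 1) ((r - r / 2) * d₀ + 1) +
      min (d₁ + 1) d₂ := by
  have hceil : ⌈(2 * ((d₁ : ℚ) + 1) - min ((d₁ : ℚ) + 1) (d₂ : ℚ)) /
      (2 * min ((d₁ : ℚ) + 1) ((d₀ : ℚ) + 1) - 2)⌉ ≤ ((r / 2 : ℕ) : ℤ) := by omega
  have hmin : 2 * min ((d₁ : ℚ) + 1) ((d₀ : ℚ) + 1) - 2 = 2 * (min d₁ d₀ : ℕ) := by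
    rw [min_add_add_right]
    push_cast
    ring
  have hpos : (0 : ℚ) < 2 * (min d₁ d₀ : ℕ) := by
    exact_mod_cast (by omega : 0 < 2 * min d₁ d₀)
  rw [Int.ceil_le, hmin, div_le_iff₀ hpos, sub_le_iff_le_add] at hceil
  have hkey : 2 * (d₁ + 1) ≤ r / 2 * (2 * min d₁ d₀) + min (d₁ + 1) d₂ := by
    exact_mod_cast hceil
  have hfloor : r / 2 * min d₁ d₀ ≤ r / 2 * d₀ := Nat.mul_le_mul_left _ (min_le_right _ _)
  have hhalf : r / 2 * d₀ ≤ (r - r / 2) * d₀ := Nat.mul_le_mul_right _ (by omega)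
  rw [mul_left_comm] at hkey
  omega

end PNN

theorem mainTheorem12_general (𝕜 : Type*) [NontriviallyNormedField 𝕜] [CharZero 𝕜] [ProperSpace 𝕜]
    [MeasureSpace 𝕜] [BorelSpace 𝕜] [(volume : Measure 𝕜).IsAddHaarMeasure] (d₀ d₁ d₂ r : ℕ)
    (h₀ : 0 < d₀) (h₁ : 0 < d₁) (h₂ : 2 ≤ d₂)
    (hdeg : (r : ℤ) ≥
      2 * ⌈(2 * ((d₁ : ℚ) + 1) - min ((d₁ : ℚ) + 1) (d₂ : ℚ)) /
        (2 * min ((d₁ : ℚ) + 1) ((d₀ : ℚ) + 1) - 2)⌉) :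
    PNN.Identifiable 𝕜 d₀ d₁ d₂ r := by
  have hcard := PNN.two_mul_add_two_le_of_ceil_le h₀ h₁ h₂ hdeg
  have hr : 0 < r / 2 := by
    by_contra! hr
    simp only [Nat.le_zero.1 hr, zero_mul] at hcard
    omega
  filter_upwards [PNN.ae_kruskalIndep_innerForm, PNN.ae_kruskalIndep_outerCol] with θ hφ hw
  have hθ := PNN.hasUniqueRepresentation_of_kruskalIndep hr hφ hw hcard
  rwa [Nat.add_sub_of_le (Nat.div_le_self r 2)] at hθ

theorem mainTheorem12 (d₀ d₁ d₂ r : ℕ) (h₀ : 2 ≤ d₀) (h₁ : 2 ≤ d₁) (h₂ : 2 ≤ d₂) (hr : 2 ≤ r)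
    (hdeg : (r : ℤ) ≥
      2 * ⌈(2 * ((d₁ : ℚ) + 1) - min ((d₁ : ℚ) + 1) (d₂ : ℚ)) /
        (2 * min ((d₁ : ℚ) + 1) ((d₀ : ℚ) + 1) - 2)⌉) :
    PNN.Identifiable ℝ d₀ d₁ d₂ r ∧ PNN.Identifiable ℂ d₀ d₁ d₂ r :=
  ⟨mainTheorem12_general ℝ d₀ d₁ d₂ r (by omega) (by omega) h₂ hdeg,
    mainTheorem12_general ℂ d₀ d₁ d₂ r (by omega) (by omega) h₂ hdeg⟩
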